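/- Let $G=GL_n(\mathbb{C})$, let $V$ be a finite-dimensional complex representation of $G$, and let $\mathbb{P}(V)$ be the projective space of lines through the origin in $V$, with the induced action of $G$ and with the complex topology. Let $\mathbb{C}[V]=\bigoplus_d\mathbb{C}[V]_d$ be the coordinate ring of $V$ (polynomial functions on $V$, graded by degree), on which $G$ acts by $(\sigma\cdot f)(x)=f(\sigma^{-1}x)$. For $v\in\mathbb{P}(V)$ let $G_v=\{\sigma\in G:\sigma v=v\}$ be its stabilizer, let $\mathbb{C}v\subseteq V$ be the corresponding line, which is a one-dimensional representation of $G_v$, let $\Delta_V[v]=\overline{Gv}\subseteq\mathbb{P}(V)$ be the closure of the orbit of $v$ in the complex topology, and let $I_V[v]\subseteq\mathbb{C}[V]$ be the ideal of $\Delta_V[v]$, i.e. the ideal generated by the homogeneous forms that vanish on $\Delta_V[v]$. For $d\ge 0$ let $\Pi_v(d)$ be the set of all irreducible $G$-submodules $S\subseteq\mathbb{C}[V]_d$ whose dual $S^*$ contains no $G_v$-submodule isomorphic to $(\mathbb{C}v)^{\otimes d}$ (equivalently, to the dual of the $G_v$-module of degree $d$ forms on the line $\mathbb{C}v$), and let $\Pi_v=\bigcup_d\Pi_v(d)$.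 **Proposition.** Suppose that $v\in\mathbb{P}(V)$ is characterized by its stabilizer, i.e. $v$ is the only point of $\mathbb{P}(V)$ that is fixed by every element of $G_v$. Then every $S\in\Pi_v$ is contained in $I_V[v]$. -/

import Mathlib

open scoped LinearAlgebra.Projectivization TensorProduct

noncomputable section

namespace OrbitClosure

/-! ### The coordinate ring of a complex vector space -/

section CoordinateRing

variable (V : Type*) [AddCommGroup V] [Module ℂ V]

/-- The inclusion of the linear forms on `V` into the functions on `V`. -/
def linearForms : Module.Dual ℂ V →ₗ[ℂ] (V → ℂ) where
  toFun l := fun x => l x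
  map_add' _ _ := rfl
  map_smul' _ _ := rfl

/-- The coordinate ring `ℂ[V]`: the algebra of polynomial functions on `V`, that is, the algebra
of functions generated by the linear forms. -/
def coordRing : Subalgebra ℂ (V → ℂ) :=
  Algebra.adjoin ℂ (Set.range (linearForms V))

/-- Linear forms as elements of `ℂ[V]`. -/
def coordRing.ofDual : Module.Dual ℂ V →ₗ[ℂ] coordRing V :=
  (linearForms V).codRestrict (Subalgebra.toSubmodule (coordRing V))
    (fun l => Algebra.subset_adjoin ⟨l, rfl⟩)

/-- The homogeneous component `ℂ[V]_d`: the linear span of the products of `d` linear forms. -/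
def homogeneousPart (d : ℕ) : Submodule ℂ (coordRing V) :=
  LinearMap.range (coordRing.ofDual V) ^ d

variable {V}

/-- Composition with a linear endomorphism of `V`, as an endomorphism of the algebra of all
functions on `V`. -/
def precomp (A : V →ₗ[ℂ] V) : (V → ℂ) →ₐ[ℂ] (V → ℂ) where
  toFun f := fun x => f (A x)
  map_one' := rfl
  map_mul' _ _ := rfl
  map_zero' := rfl
  map_add' _ _ := rfl
  commutes' _ := rfl

theorem precomp_mem (A : V →ₗ[ℂ] V) {f : V → ℂ} (hf : f ∈ coordRing V) :
    precomp A f ∈ coordRing V := by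
  have h : coordRing V ≤ (coordRing V).comap (precomp A) := by
    refine Algebra.adjoin_le ?_
    rintro _ ⟨l, rfl⟩
    exact Algebra.subset_adjoin ⟨l.comp A, rfl⟩
  exact h hf

/-- The action of a group `G` on `ℂ[V]` induced by a representation on `V`:
`(σ • f) x = f (σ⁻¹ x)`. -/
def coordRep {G : Type*} [Group G] (ρ : Representation ℂ G V) :
    Representation ℂ G (coordRing V) where
  toFun σ :=
    { toFun := fun f => ⟨fun x => (f : V → ℂ) (ρ σ⁻¹ x), precomp_mem (ρ σ⁻¹) f.2⟩
      map_add' := fun _ _ => rfl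
      map_smul' := fun _ _ => rfl }
  map_one' := by
    ext f x
    simp
  map_mul' σ τ := by
    ext f x
    simp

end CoordinateRing

/-! ### Projective space, orbit closures and their ideals -/

section Projective

variable {V : Type*} [AddCommGroup V] [Module ℂ V]

/-- The complex topology on `ℙ(V)`: the quotient topology from `V ∖ {0}`. -/
instance projectiveTopology [TopologicalSpace V] : TopologicalSpace (ℙ ℂ V) :=
  TopologicalSpace.coinduced (fun w : { w : V // w ≠ 0 } => Projectivization.mk ℂ w.1 w.2)
    inferInstance

/-- The ideal in `ℂ[V]` of a subset `Y` of `ℙ(V)`: the ideal generated by the homogeneous forms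
that vanish at all points of `Y`. -/
def projectiveIdeal (Y : Set (ℙ ℂ V)) : Ideal (coordRing V) :=
  Ideal.span { f | (∃ d, f ∈ homogeneousPart V d) ∧
    ∀ (w : V) (hw : w ≠ 0), Projectivization.mk ℂ w hw ∈ Y → (f : V → ℂ) w = 0 }

variable {G : Type*} [Group G] (ρ : Representation ℂ G V)

/-- The orbit `Gv` in `ℙ(V)`. -/
def orbit (v : ℙ ℂ V) : Set (ℙ ℂ V) :=
  Set.range fun σ : G => ρ.asGroupHom σ • v

/-- The orbit closure `Δ_V[v]` in the complex topology of `ℙ(V)`. -/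
def orbitClosure [TopologicalSpace V] (v : ℙ ℂ V) : Set (ℙ ℂ V) :=
  closure (orbit ρ v)

/-- The ideal `I_V[v]` of the orbit closure `Δ_V[v]`. -/
def orbitClosureIdeal [TopologicalSpace V] (v : ℙ ℂ V) : Ideal (coordRing V) :=
  projectiveIdeal (orbitClosure ρ v)

/-- The stabilizer `G_v` of a point `v` of `ℙ(V)`. -/
def stabilizer (v : ℙ ℂ V) : Subgroup G where
  carrier := { σ | ρ.asGroupHom σ • v = v }
  one_mem' := by simp
  mul_mem' {a b} ha hb := by
    change ρ.asGroupHom (a * b) • v = v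
    change ρ.asGroupHom a • v = v at ha
    change ρ.asGroupHom b • v = v at hb
    rw [map_mul, mul_smul, hb, ha]
  inv_mem' {a} ha := by
    change ρ.asGroupHom a⁻¹ • v = v
    change ρ.asGroupHom a • v = v at ha
    rw [map_inv, inv_smul_eq_iff, ha]

theorem mem_stabilizer {v : ℙ ℂ V} {σ : G} :
    σ ∈ stabilizer ρ v ↔ ρ.asGroupHom σ • v = v := Iff.rfl

/-- `v` is characterized by its stabilizer: it is the only point of `ℙ(V)` fixed by `G_v`. -/
def CharacterizedByStabilizer (v : ℙ ℂ V) : Prop :=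
  ∀ w : ℙ ℂ V, (∀ h ∈ stabilizer ρ v, ρ.asGroupHom h • w = w) → w = v

/-! ### The representation-theoretic data of a point -/

theorem line_stable (v : ℙ ℂ V) (h : stabilizer ρ v) {x : V} (hx : x ∈ v.submodule) :
    ρ (h : G) x ∈ v.submodule := by
  have hv : ρ.asGroupHom (h : G) • v = v := h.2
  induction v using Projectivization.ind with
  | h w hw =>
    rw [Projectivization.generalLinearGroup_smul_def, Projectivization.map_mk,
      Projectivization.mk_eq_mk_iff'] at hv
    obtain ⟨a, ha⟩ := hv
    have ha' : a • w = ρ (h : G) w := ha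
    rw [Projectivization.submodule_mk, Submodule.mem_span_singleton] at hx ⊢
    obtain ⟨c, rfl⟩ := hx
    exact ⟨c * a, by rw [map_smul, ← ha', mul_smul]⟩

/-- The line `ℂv ⊆ V` as a representation of `G_v`. -/
def lineRep (v : ℙ ℂ V) : Representation ℂ (stabilizer ρ v) v.submodule where
  toFun h := (ρ (h : G)).restrict fun _ hx => line_stable ρ v h hx
  map_one' := by ext; simp
  map_mul' _ _ := by ext; simp

/-- The `d`-th tensor power of a representation. -/
def tensorPowerRep {H W : Type*} [Group H] [AddCommGroup W] [Module ℂ W]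
    (τ : Representation ℂ H W) (d : ℕ) : Representation ℂ H (⨂[ℂ]^d W) where
  toFun h := PiTensorProduct.map fun _ => τ h
  map_one' := by
    simp only [map_one]
    exact PiTensorProduct.map_one
  map_mul' g h := by
    simp only [map_mul]
    exact PiTensorProduct.map_mul _ _

/-- The restriction of a representation to a subgroup. -/
def restrictRep {W : Type*} [AddCommGroup W] [Module ℂ W] (τ : Representation ℂ G W)
    (H : Subgroup G) : Representation ℂ H W :=
  τ.comp H.subtype

/-- `Π_v(d)`: the irreducible `G`-submodules `S` of `ℂ[V]_d` whose dual `S^*` does not contain a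
`G_v`-submodule isomorphic to `(ℂv)^{⊗d}`. -/
def stabilizerData (v : ℙ ℂ V) (d : ℕ) : Set (Subrepresentation (coordRep ρ)) :=
  { S | S.toSubmodule ≤ homogeneousPart V d ∧
    Representation.IsIrreducible (k := ℂ) (G := G) (V := S.toSubmodule) S.toRepresentation ∧
    ¬ ∃ T : Subrepresentation (restrictRep S.toRepresentation.dual (stabilizer ρ v)),
      Nonempty (T.toRepresentation.Equiv (tensorPowerRep (lineRep ρ v) d)) }

end Projective

end OrbitClosure

end

namespace OrbitClosure

/-! Let `w` represent `v`, and regard evaluation at `w` as an element of `S^*`. If `h` in `G_v`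
scales `w` by `a`, homogeneity of degree `d` makes `h` scale this evaluation by `a ^ d`, which is
the character of `G_v` on `(ℂv)^{⊗d}`. A nonzero evaluation would therefore span a copy of
`(ℂv)^{⊗d}` in `S^*` (`nonempty_equiv_evalLine`), which membership in `Π_v(d)` excludes. So `S`
vanishes at `w`; being `G`-stable it vanishes on the orbit, and by continuity on the orbit closure.
Its members are then among the generators of the ideal. -/

/-- A vector representing a fixed line is an eigenvector of every element of the stabilizer. -/
theorem exists_smul_eq_of_mem_stabilizer {V G : Type*} [AddCommGroup V] [Module ℂ V] [Group G]
    (ρ : Representation ℂ G V) {w : V} (hw : w ≠ 0) {h : G}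
    (hh : h ∈ stabilizer ρ (Projectivization.mk ℂ w hw)) : ∃ a : ℂ, a • w = ρ h w := by
  rw [mem_stabilizer, Projectivization.generalLinearGroup_smul_def, Projectivization.map_mk,
    Projectivization.mk_eq_mk_iff'] at hh
  exact hh

section CoordinateRing

variable {V : Type*} [AddCommGroup V] [Module ℂ V]

/-- A form of degree `d` is homogeneous of degree `d` as a function. -/
theorem homogeneousPart_apply_smul {d : ℕ} {f : coordRing V} (hf : f ∈ homogeneousPart V d)
    (c : ℂ) (x : V) : (f : V → ℂ) (c • x) = c ^ d * (f : V → ℂ) x := by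
  induction hf using Submodule.pow_induction_on_left' with
  | algebraMap r => simp [Pi.algebraMap_apply]
  | add f g i _ _ hf hg =>
    change (f : V → ℂ) (c • x) + (g : V → ℂ) (c • x) = c ^ i * ((f : V → ℂ) x + (g : V → ℂ) x)
    rw [hf, hg, mul_add]
  | mem_mul m hm i f _ hf =>
    obtain ⟨l, rfl⟩ := hm
    change l (c • x) * (f : V → ℂ) (c • x) = c ^ (i + 1) * (l x * (f : V → ℂ) x)
    rw [hf, map_smul, smul_eq_mul]
    ring

/-- Polynomial functions are continuous. -/
theorem continuous_coordRing [FiniteDimensional ℂ V] [TopologicalSpace V]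
    [IsTopologicalAddGroup V] [ContinuousSMul ℂ V] [T2Space V] (f : coordRing V) :
    Continuous (f : V → ℂ) := by
  obtain ⟨f, hf⟩ := f
  change Continuous f
  induction hf using Algebra.adjoin_induction with
  | mem f hf =>
    obtain ⟨l, rfl⟩ := hf
    exact l.continuous_of_finiteDimensional
  | algebraMap r => exact continuous_const
  | add f g _ _ hf hg => exact hf.add hg
  | mul f g _ _ hf hg => exact hf.mul hg

/-- A form that vanishes on a subset of `ℙ(V)` vanishes on its closure. -/
theorem apply_eq_zero_of_mem_closure [FiniteDimensional ℂ V] [TopologicalSpace V]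
    [IsTopologicalAddGroup V] [ContinuousSMul ℂ V] [T2Space V] {d : ℕ} {f : coordRing V}
    (hf : f ∈ homogeneousPart V d) {Y : Set (ℙ ℂ V)}
    (hY : ∀ (w : V) (hw : w ≠ 0), Projectivization.mk ℂ w hw ∈ Y → (f : V → ℂ) w = 0)
    (w : V) (hw : w ≠ 0) (hwY : Projectivization.mk ℂ w hw ∈ closure Y) :
    (f : V → ℂ) w = 0 := by
  -- Quantifying over all representatives turns the zero locus of `f` into a subset of `ℙ(V)`.
  let Z : Set (ℙ ℂ V) :=
    { p | ∀ (w : V) (hw : w ≠ 0), Projectivization.mk ℂ w hw = p → (f : V → ℂ) w = 0 }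
  have hZ : IsClosed Z := by
    -- In the quotient topology, closedness is tested on the preimage in `V ∖ {0}`.
    rw [← isOpen_compl_iff, isOpen_coinduced, Set.preimage_compl, isOpen_compl_iff]
    have : (fun w : { w : V // w ≠ 0 } => Projectivization.mk ℂ w.1 w.2) ⁻¹' Z =
        { w | (f : V → ℂ) w.1 = 0 } := by
      ext ⟨w, hw⟩
      refine ⟨fun h => h w hw rfl, fun h u hu huw => ?_⟩
      obtain ⟨a, rfl⟩ := (Projectivization.mk_eq_mk_iff' ℂ u w hu hw).1 huw
      rw [homogeneousPart_apply_smul hf, show (f : V → ℂ) w = 0 from h, mul_zero]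
    rw [this]
    exact isClosed_eq ((continuous_coordRing f).comp continuous_subtype_val) continuous_const
  have hYZ : Y ⊆ Z := by
    rintro _ hp w hw rfl
    exact hY w hw hp
  exact closure_minimal hYZ hZ hwY w hw rfl

/-- Evaluation at a point, as a linear form on a space of polynomial functions. -/
noncomputable def evalAt (S : Submodule ℂ (coordRing V)) (x : V) : Module.Dual ℂ S where
  toFun f := ((f : coordRing V) : V → ℂ) x
  map_add' _ _ := rfl
  map_smul' _ _ := rfl

@[simp]
theorem evalAt_apply (S : Submodule ℂ (coordRing V)) (x : V) (f : S) :
    evalAt S x f = ((f : coordRing V) : V → ℂ) x := rfl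

end CoordinateRing

/-! ### The character of the stabilizer on tensor powers of the line -/

section LineCoordinate

variable {V G : Type*} [AddCommGroup V] [Module ℂ V] [Group G] (ρ : Representation ℂ G V)
  {w : V} (hw : w ≠ 0)

/-- The coordinate on the line through `w` that takes the value `1` at `w`. -/
noncomputable def lineCoord : (Projectivization.mk ℂ w hw).submodule ≃ₗ[ℂ] ℂ :=
  ((LinearEquiv.toSpanNonzeroSingleton ℂ V w hw).trans
    (LinearEquiv.ofEq _ _ (Projectivization.submodule_mk w hw).symm)).symm

theorem lineCoord_smul (x : (Projectivization.mk ℂ w hw).submodule) :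
    lineCoord hw x • w = x :=
  congrArg Subtype.val ((lineCoord hw).symm_apply_apply x)

theorem lineCoord_lineRep {a : ℂ} {h : stabilizer ρ (Projectivization.mk ℂ w hw)}
    (ha : a • w = ρ (h : G) w) (x : (Projectivization.mk ℂ w hw).submodule) :
    lineCoord hw (lineRep ρ _ h x) = a * lineCoord hw x := by
  refine smul_left_injective ℂ hw ?_
  change lineCoord hw (lineRep ρ _ h x) • w = (a * lineCoord hw x) • w
  rw [lineCoord_smul]
  change ρ (h : G) x = _
  rw [← lineCoord_smul hw x, map_smul, ← ha, smul_smul, mul_comm]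

/-- The `d`-th tensor power of the line through `w` is one-dimensional. -/
noncomputable def tensorLineCoord (d : ℕ) : (⨂[ℂ]^d (Projectivization.mk ℂ w hw).submodule) ≃ₗ[ℂ] ℂ :=
  (PiTensorProduct.congr fun _ : Fin d => lineCoord hw).trans
    (PiTensorProduct.constantBaseRingEquiv (Fin d) ℂ).toLinearEquiv

theorem tensorLineCoord_tprod {d : ℕ} (x : Fin d → (Projectivization.mk ℂ w hw).submodule) :
    tensorLineCoord hw d (PiTensorProduct.tprod ℂ x) = ∏ i, lineCoord hw (x i) := by
  change PiTensorProduct.constantBaseRingEquiv (Fin d) ℂ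
    (PiTensorProduct.congr (fun _ => lineCoord hw) (PiTensorProduct.tprod ℂ x)) = _
  rw [PiTensorProduct.congr_tprod, PiTensorProduct.constantBaseRingEquiv_tprod]

/-- Each of the `d` tensor factors contributes one scalar `a`; it suffices to check this on pure
tensors. -/
theorem tensorLineCoord_tensorPowerRep {a : ℂ}
    {h : stabilizer ρ (Projectivization.mk ℂ w hw)} (ha : a • w = ρ (h : G) w) {d : ℕ}
    (t : ⨂[ℂ]^d (Projectivization.mk ℂ w hw).submodule) :
    tensorLineCoord hw d (tensorPowerRep (lineRep ρ _) d h t) =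
      a ^ d * tensorLineCoord hw d t := by
  suffices (tensorLineCoord hw d).toLinearMap ∘ₗ tensorPowerRep (lineRep ρ _) d h =
      a ^ d • (tensorLineCoord hw d).toLinearMap from LinearMap.congr_fun this t
  ext x
  change tensorLineCoord hw d (PiTensorProduct.map (fun _ => lineRep ρ _ h)
    (PiTensorProduct.tprod ℂ x)) = a ^ d * tensorLineCoord hw d (PiTensorProduct.tprod ℂ x)
  rw [PiTensorProduct.map_tprod, tensorLineCoord_tprod, tensorLineCoord_tprod]
  rw [Finset.prod_congr rfl fun i _ => lineCoord_lineRep ρ hw ha (x i), Finset.prod_mul_distrib,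
    Fin.prod_const]

/-! ### Evaluation at `w` as a vector of `S^*` -/

variable (S : Subrepresentation (coordRep ρ))

/-- Evaluation at `w` on a space of forms of degree `d` is an eigenvector of the stabilizer. -/
theorem dual_evalAt {d : ℕ} (hS : S.toSubmodule ≤ homogeneousPart V d) {a : ℂ} {h : G}
    (ha : a • w = ρ h w) :
    S.toRepresentation.dual h (evalAt S.toSubmodule w) = a ^ d • evalAt S.toSubmodule w := by
  ext f
  -- The dual action and the action on functions each invert `h`, so the point of evaluation is `h
  -- w`.
  change ((f : coordRing V) : V → ℂ) (ρ h⁻¹⁻¹ w) = a ^ d * ((f : coordRing V) : V → ℂ) w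
  rw [inv_inv, ← ha, homogeneousPart_apply_smul (hS f.2)]

/-- The line in `S^*` spanned by evaluation at `w`, as a representation of the stabilizer. -/
noncomputable def evalLine {d : ℕ} (hS : S.toSubmodule ≤ homogeneousPart V d) :
    Subrepresentation (restrictRep S.toRepresentation.dual
      (stabilizer ρ (Projectivization.mk ℂ w hw))) where
  toSubmodule := ℂ ∙ evalAt S.toSubmodule w
  apply_mem_toSubmodule h u hu := by
    obtain ⟨a, ha⟩ := exists_smul_eq_of_mem_stabilizer ρ hw h.2
    obtain ⟨c, rfl⟩ := Submodule.mem_span_singleton.1 hu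
    change S.toRepresentation.dual (h : G) (c • evalAt S.toSubmodule w) ∈ _
    rw [map_smul, dual_evalAt ρ S hS ha]
    exact Submodule.smul_mem _ _ (Submodule.smul_mem _ _ (Submodule.mem_span_singleton_self _))

/-- If some member of `S` does not vanish at `w`, then `S^*` contains the `d`-th tensor power of
the line through `w`. -/
theorem nonempty_equiv_evalLine {d : ℕ} (hS : S.toSubmodule ≤ homogeneousPart V d)
    (hev : evalAt S.toSubmodule w ≠ 0) :
    Nonempty ((evalLine ρ hw S hS).toRepresentation.Equiv
      (tensorPowerRep (lineRep ρ (Projectivization.mk ℂ w hw)) d)) := by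
  -- Both lines are identified with `ℂ`; equivariance holds because `h` acts on each by `a ^ d`.
  let E : (⨂[ℂ]^d (Projectivization.mk ℂ w hw).submodule) ≃ₗ[ℂ]
      (evalLine ρ hw S hS).toSubmodule :=
    (tensorLineCoord hw d).trans (LinearEquiv.toSpanNonzeroSingleton ℂ _ _ hev)
  refine ⟨(Representation.Equiv.mk E fun h => ?_).symm⟩
  obtain ⟨a, ha⟩ := exists_smul_eq_of_mem_stabilizer ρ hw h.2
  refine LinearMap.ext fun t => Subtype.ext ?_
  change tensorLineCoord hw d (tensorPowerRep (lineRep ρ _) d h t) • evalAt S.toSubmodule w =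
    S.toRepresentation.dual (h : G) (tensorLineCoord hw d t • evalAt S.toSubmodule w)
  rw [tensorLineCoord_tensorPowerRep ρ hw ha, map_smul, dual_evalAt ρ S hS ha, smul_smul, mul_comm]

/-- The members of an element of `Π_v(d)` vanish on the orbit of `v`. -/
theorem apply_eq_zero_of_mem_orbit {v : ℙ ℂ V} {d : ℕ} (hS : S ∈ stabilizerData ρ v d)
    {f : coordRing V} (hf : f ∈ S) (u : V) (hu : u ≠ 0)
    (huv : Projectivization.mk ℂ u hu ∈ orbit ρ v) : (f : V → ℂ) u = 0 := by
  induction v using Projectivization.ind with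
  | h w hw =>
    obtain ⟨hd, -, hT⟩ := hS
    have hev : evalAt S.toSubmodule w = 0 := by
      by_contra hev
      exact hT ⟨_, nonempty_equiv_evalLine ρ hw S hd hev⟩
    obtain ⟨σ, hσ⟩ := huv
    replace hσ : Projectivization.mk ℂ u hu = ρ.asGroupHom σ • Projectivization.mk ℂ w hw :=
      hσ.symm
    rw [Projectivization.generalLinearGroup_smul_def, Projectivization.map_mk,
      Projectivization.mk_eq_mk_iff'] at hσ
    obtain ⟨a, ha⟩ := hσ
    have ha' : a • ρ σ w = u := ha
    -- Evaluation at `w` kills `σ⁻¹ • f`, which lies in `S` by stability; its value there is `f (σ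
    -- w)`.
    have hσf : (f : V → ℂ) (ρ σ⁻¹⁻¹ w) = 0 :=
      LinearMap.congr_fun hev ⟨coordRep ρ σ⁻¹ f, S.apply_mem_toSubmodule σ⁻¹ hf⟩
    rw [inv_inv] at hσf
    rw [← ha', homogeneousPart_apply_smul (hd hf), hσf, mul_zero]

end LineCoordinate

end OrbitClosure

theorem mainTheorem5 (n : ℕ) {V : Type*} [AddCommGroup V] [Module ℂ V] [FiniteDimensional ℂ V]
    [TopologicalSpace V] [IsTopologicalAddGroup V] [ContinuousSMul ℂ V] [T2Space V]
    (ρ : Representation ℂ (Matrix.GeneralLinearGroup (Fin n) ℂ) V) (v : ℙ ℂ V)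
    (hv : OrbitClosure.CharacterizedByStabilizer ρ v) (d : ℕ)
    (S : Subrepresentation (OrbitClosure.coordRep ρ))
    (hS : S ∈ OrbitClosure.stabilizerData ρ v d) :
    ∀ f ∈ S, f ∈ OrbitClosure.orbitClosureIdeal ρ v := fun _ hf =>
  Ideal.subset_span ⟨⟨d, hS.1 hf⟩, OrbitClosure.apply_eq_zero_of_mem_closure (hS.1 hf)
    (OrbitClosure.apply_eq_zero_of_mem_orbit ρ S hS hf)⟩
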